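/- Let $n\ge 0$ and $s\ge 1$ be integers, and let $\bar M$ be a smooth (Hausdorff) manifold of dimension $2n+s$ with a Riemannian metric $g$. Suppose that $\bar M$ is a \emph{generalized Kenmotsu manifold}. This means the following. There are a smooth $(1,1)$-tensor field $\varphi$, smooth vector fields $\xi_1,\dots,\xi_s$ and smooth $1$-forms $\eta^1,\dots,\eta^s$ on $\bar M$ with $$\varphi^2=-I+\sum_{i=1}^s\eta^i\otimes\xi_i,\qquad \eta^i(\xi_j)=\delta_{ij},\qquad \varphi\xi_i=0,\qquad g(\varphi X,\varphi Y)=g(X,Y)-\sum_{i=1}^s\eta^i(X)\eta^i(Y).$$ With $\Phi(X,Y)=g(X,\varphi Y)$, the form $\eta^1\wedge\dots\wedge\eta^s\wedge\Phi^n$ vanishes nowhere, every $\eta^i$ is closed, $d\Phi=2\sum_{i=1}^s\eta^i\wedge\Phi$, and the structure is normal, i.e. $[\varphi,\varphi]+2\sum_{i=1}^s d\eta^i\otimes\xi_i=0$, where $[\varphi,\varphi]$ is the Nijenhuis tensor of $\varphi$. Let $M$ be an invariant submanifold of $\bar M$, that is, an isometrically immersed smooth (Hausdorff) Riemannian manifold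 such that $\varphi(T_xM)\subset T_xM$ for all $x\in M$ and such that $\xi_1,\dots,\xi_s$ are tangent to $M$ along $M$. Let $\bar\nabla$ and $\nabla$ be the Levi-Civita connections of $\bar M$ and $M$. Let $h(X,Y)=(\bar\nabla_XY)^\perp$ be the second fundamental form of $M$, let $\nabla^\perp_XN=(\bar\nabla_XN)^\perp$ be the normal connection, and put $$(\nabla_Xh)(Y,Z)=\nabla^\perp_X\big(h(Y,Z)\big)-h(\nabla_XY,Z)-h(Y,\nabla_XZ).$$ Then the restrictions of $\xi_1,\dots,\xi_s$ to $M$ are smooth vector fields on $M$, and for all smooth vector fields $X,Y$ on $M$ and all $i\in\{1,\dots,s\}$, $$(\nabla_Xh)(Y,\xi_i)=-h(Y,\nabla_X\xi_i)=-h(X,Y).$$ Moreover, $h$ is parallel, i.e. $(\nabla_Xh)(Y,Z)=0$ for all smooth vector fields $X,Y,Z$ on $M$, if and only if $M$ is totally geodesic, i.e. $h(X,Y)=0$ for all smooth vector fields $X,Y$ on $M$. -/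

import Mathlib

open Bundle Manifold
open scoped ContDiff

noncomputable section

namespace GenKenmotsu

section Manifold

variable {F : Type*} [NormedAddCommGroup F] [NormedSpace ℝ F]
  {G : Type*} [TopologicalSpace G] (J : ModelWithCorners ℝ F G)
  {N : Type*} [TopologicalSpace N] [ChartedSpace G N]

/-- The exterior derivative of a `1`-form `η`, evaluated on two vector fields:
`dη(X, Y) = (1/2) (X η(Y) - Y η(X) - η([X, Y]))`. -/
def extDerivOne (η : Π x : N, TangentSpace J x →L[ℝ] ℝ) (X Y : Π x : N, TangentSpace J x)
    (x : N) : ℝ :=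
  (1 / 2 : ℝ) * (mvfderiv J (fun y => η y (Y y)) x (X x)
    - mvfderiv J (fun y => η y (X y)) x (Y x)
    - η x (VectorField.mlieBracket J X Y x))

/-- The exterior derivative of a `2`-form `β`, evaluated on three vector fields:
`dβ(X, Y, Z) = (1/3) (X β(Y, Z) + Y β(Z, X) + Z β(X, Y) - β([X, Y], Z) - β([Y, Z], X)
- β([Z, X], Y))`. -/
def extDerivTwo (β : Π x : N, TangentSpace J x → TangentSpace J x → ℝ)
    (X Y Z : Π x : N, TangentSpace J x) (x : N) : ℝ :=
  (1 / 3 : ℝ) * (mvfderiv J (fun y => β y (Y y) (Z y)) x (X x)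
    + mvfderiv J (fun y => β y (Z y) (X y)) x (Y x)
    + mvfderiv J (fun y => β y (X y) (Y y)) x (Z x)
    - β x (VectorField.mlieBracket J X Y x) (Z x)
    - β x (VectorField.mlieBracket J Y Z x) (X x)
    - β x (VectorField.mlieBracket J Z X x) (Y x))

/-- The Nijenhuis tensor `[φ, φ]` of a field `φ` of endomorphisms of the tangent spaces:
`[φ, φ](X, Y) = φ²[X, Y] + [φX, φY] - φ[φX, Y] - φ[X, φY]`. -/
def nijenhuis (φ : Π x : N, TangentSpace J x →L[ℝ] TangentSpace J x)
    (X Y : Π x : N, TangentSpace J x) (x : N) : TangentSpace J x :=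
  φ x (φ x (VectorField.mlieBracket J X Y x))
    + VectorField.mlieBracket J (fun y => φ y (X y)) (fun y => φ y (Y y)) x
    - φ x (VectorField.mlieBracket J (fun y => φ y (X y)) Y x)
    - φ x (VectorField.mlieBracket J X (fun y => φ y (Y y)) x)

end Manifold

/-- The wedge product `η ∧ β` of a `1`-form and a `2`-form on a vector space, with the
normalization that goes with the exterior derivatives above. -/
def wedgeOneTwo {V : Type*} (η : V → ℝ) (β : V → V → ℝ) (u v w : V) : ℝ :=
  (1 / 3 : ℝ) * (η u * β v w + η v * β w u + η w * β u v)

/-- The value of `η¹ ∧ ⋯ ∧ ηˢ ∧ βⁿ` on `2n + s` vectors, for `1`-forms `ηⁱ` and a `2`-form `β`, up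
to a positive constant depending only on `n`, `s` and the normalization of the wedge product. -/
def wedgeTop {V : Type*} {n s : ℕ} (η : Fin s → V → ℝ) (β : V → V → ℝ)
    (v : Fin s ⊕ Fin n × Fin 2 → V) : ℝ :=
  ∑ σ : Equiv.Perm (Fin s ⊕ Fin n × Fin 2), ((Equiv.Perm.sign σ : ℤ) : ℝ) *
    ((∏ i : Fin s, η i (v (σ (Sum.inl i)))) *
      ∏ j : Fin n, β (v (σ (Sum.inr (j, 0)))) (v (σ (Sum.inr (j, 1)))))

section Connection

variable {F : Type*} [NormedAddCommGroup F] [NormedSpace ℝ F] [FiniteDimensional ℝ F]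
  {G : Type*} [TopologicalSpace G] {J : ModelWithCorners ℝ F G}
  {N : Type*} [TopologicalSpace N] [ChartedSpace G N] [IsManifold J ∞ N]
  [RiemannianBundle (fun x : N => TangentSpace J x)]
  [IsContMDiffRiemannianBundle J ∞ F (fun x : N => TangentSpace J x)]

/-- `D` is the Levi-Civita connection of the Riemannian manifold `N`: a smooth torsion-free affine
connection which is compatible with the metric. Here `D Y x v` is `(∇_v Y)(x)`. -/
structure IsLeviCivita (D : CovariantDerivative J F (fun x : N => TangentSpace J x)) : Prop where
  smooth : CovariantDerivative.ContMDiffCovariantDerivative D ∞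
  torsion_eq_zero : D.torsion = 0
  metric : CovariantDerivative.IsMetricCompatible (V := fun x : N => TangentSpace J x) D

end Connection

section Structure

variable (n s : ℕ) {F : Type*} [NormedAddCommGroup F] [NormedSpace ℝ F] [FiniteDimensional ℝ F]
  {G : Type*} [TopologicalSpace G] (J : ModelWithCorners ℝ F G)
  (N : Type*) [TopologicalSpace N] [ChartedSpace G N] [IsManifold J ∞ N]
  [RiemannianBundle (fun x : N => TangentSpace J x)]

/-- A metric `f`-structure `(φ, ξᵢ, ηⁱ, g)` on a `(2n + s)`-dimensional Riemannian manifold, where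
`g` is the given metric. -/
structure MetricFStructure where
  finrank_eq : Module.finrank ℝ F = 2 * n + s
  φ : Π x : N, TangentSpace J x →L[ℝ] TangentSpace J x
  ξ : Fin s → Π x : N, TangentSpace J x
  η : Fin s → Π x : N, TangentSpace J x →L[ℝ] ℝ
  smooth_φ : ContMDiff J (J.prod 𝓘(ℝ, F →L[ℝ] F)) ∞
    (fun x => TotalSpace.mk' (F →L[ℝ] F)
      (E := fun x : N => TangentSpace J x →L[ℝ] TangentSpace J x) x (φ x))
  smooth_ξ : ∀ i, ContMDiff J J.tangent ∞ (fun x => (⟨x, ξ i x⟩ : TangentBundle J N))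
  smooth_η : ∀ i, ContMDiff J (J.prod 𝓘(ℝ, F →L[ℝ] ℝ)) ∞
    (fun x => TotalSpace.mk' (F →L[ℝ] ℝ) (E := fun x : N => TangentSpace J x →L[ℝ] ℝ) x (η i x))
  φ_φ : ∀ x (v : TangentSpace J x), φ x (φ x v) = -v + ∑ i, η i x v • ξ i x
  η_ξ : ∀ x i j, η i x (ξ j x) = if i = j then 1 else 0
  φ_ξ : ∀ x i, φ x (ξ i x) = 0
  metric_φ : ∀ x (u v : TangentSpace J x),
    inner ℝ (φ x u) (φ x v) = inner ℝ u v - ∑ i, η i x u * η i x v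

variable {n s J N}

/-- The fundamental `2`-form `Φ(X, Y) = g(X, φ Y)`. -/
def MetricFStructure.Φ (S : MetricFStructure n s J N) (x : N) (u v : TangentSpace J x) : ℝ :=
  inner ℝ u (S.φ x v)

/-- A generalized Kenmotsu manifold: an almost `s`-contact metric manifold with `s ≥ 1`, such that
all `ηⁱ` are closed, `dΦ = 2 ∑ᵢ ηⁱ ∧ Φ`, and which is normal, i.e. `[φ, φ] + 2 ∑ᵢ dηⁱ ⊗ ξᵢ = 0`. The
last three are identities between tensor fields; they are tested at a point on vector fields that
are smooth at that point. -/
structure MetricFStructure.IsGeneralizedKenmotsu (S : MetricFStructure n s J N) : Prop where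
  one_le : 1 ≤ s
  nondegenerate : ∀ x : N, ∃ v : Fin s ⊕ Fin n × Fin 2 → TangentSpace J x,
    wedgeTop (fun i => S.η i x) (S.Φ x) v ≠ 0
  closed : ∀ (i : Fin s) (x : N) (X Y : Π x : N, TangentSpace J x),
    ContMDiffAt J J.tangent ∞ (fun y => (⟨y, X y⟩ : TangentBundle J N)) x →
    ContMDiffAt J J.tangent ∞ (fun y => (⟨y, Y y⟩ : TangentBundle J N)) x →
    extDerivOne J (S.η i) X Y x = 0
  dΦ_eq : ∀ (x : N) (X Y Z : Π x : N, TangentSpace J x),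
    ContMDiffAt J J.tangent ∞ (fun y => (⟨y, X y⟩ : TangentBundle J N)) x →
    ContMDiffAt J J.tangent ∞ (fun y => (⟨y, Y y⟩ : TangentBundle J N)) x →
    ContMDiffAt J J.tangent ∞ (fun y => (⟨y, Z y⟩ : TangentBundle J N)) x →
    extDerivTwo J S.Φ X Y Z x = 2 * ∑ i, wedgeOneTwo (S.η i x) (S.Φ x) (X x) (Y x) (Z x)
  normal : ∀ (x : N) (X Y : Π x : N, TangentSpace J x),
    ContMDiffAt J J.tangent ∞ (fun y => (⟨y, X y⟩ : TangentBundle J N)) x →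
    ContMDiffAt J J.tangent ∞ (fun y => (⟨y, Y y⟩ : TangentBundle J N)) x →
    nijenhuis J S.φ X Y x + (2 : ℝ) • ∑ i, extDerivOne J (S.η i) X Y x • S.ξ i x = 0

end Structure

section Submanifold

variable {E : Type*} [NormedAddCommGroup E] [NormedSpace ℝ E] [FiniteDimensional ℝ E]
  {H : Type*} [TopologicalSpace H] {I : ModelWithCorners ℝ E H}
  {M : Type*} [TopologicalSpace M] [ChartedSpace H M] [IsManifold I ∞ M]
  {F : Type*} [NormedAddCommGroup F] [NormedSpace ℝ F] [FiniteDimensional ℝ F]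
  {G : Type*} [TopologicalSpace G] {J : ModelWithCorners ℝ F G}
  {N : Type*} [TopologicalSpace N] [ChartedSpace G N] [IsManifold J ∞ N]

/-- The covariant derivative, with respect to a connection `D` on `N`, of a vector field `V` along a
map `f : M → N` (the pull-back connection): `covAlong D f V x v = (∇_v V)(x)`. In the
trivialization of the tangent bundle around `f x`, this is the usual "derivative of the components,
plus covariant derivative of the field with the same components, frozen at `x`". -/
def covAlong (D : CovariantDerivative J F (fun x : N => TangentSpace J x)) (f : M → N)
    (V : Π x : M, TangentSpace J (f x)) (x : M) :
    TangentSpace I x →L[ℝ] TangentSpace J (f x) :=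
  let t := trivializationAt F (TangentSpace J : N → Type _) (f x)
  let c : M → F := fun y => (t (⟨f y, V y⟩ : TangentBundle J N)).2
  t.symmL ℝ (f x) ∘L mvfderiv I c x
    + D (fun z => t.symmL ℝ z (c x)) (f x) ∘L mfderiv I J f x

variable [RiemannianBundle (fun x : N => TangentSpace J x)]

variable (I J) in
/-- `f` is an isometric immersion, i.e. `M` is an immersed submanifold of `N` with the induced
metric. -/
structure IsIsometricImmersion [RiemannianBundle (fun x : M => TangentSpace I x)]
    (f : M → N) : Prop where
  immersion : Manifold.IsImmersion I J ∞ f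
  isometric : ∀ x (u v : TangentSpace I x),
    inner ℝ (mfderiv I J f x u) (mfderiv I J f x v) = inner ℝ u v

variable (I) in
/-- The submanifold `f : M → N` is invariant: `φ` maps tangent vectors of `M` to tangent vectors of
`M`, and all `ξᵢ` are tangent to `M`. -/
structure IsInvariant {n s : ℕ} (S : MetricFStructure n s J N) (f : M → N) : Prop where
  φ_mem : ∀ x (u : TangentSpace I x), ∃ v : TangentSpace I x,
    mfderiv I J f x v = S.φ (f x) (mfderiv I J f x u)
  ξ_mem : ∀ i x, ∃ v : TangentSpace I x, mfderiv I J f x v = S.ξ i (f x)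

instance (f : M → N) (x : M) : (mfderiv I J f x).range.HasOrthogonalProjection :=
  haveI : FiniteDimensional ℝ (TangentSpace I x) := inferInstanceAs (FiniteDimensional ℝ E)
  haveI : CompleteSpace (mfderiv I J f x).range := FiniteDimensional.complete ℝ _
  inferInstance

variable (I) in
/-- The normal component of a vector `w ∈ T_{f x} N`: its projection to the orthogonal complement of
the tangent space of the submanifold. -/
def normalPart (f : M → N) (x : M) (w : TangentSpace J (f x)) : TangentSpace J (f x) :=
  (mfderiv I J f x).rangeᗮ.starProjection w

/-- The second fundamental form of `f`: `h(X, Y)` is the normal component of `∇̄_X Y`. -/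
def secondFF (D : CovariantDerivative J F (fun x : N => TangentSpace J x)) (f : M → N)
    (X Y : Π x : M, TangentSpace I x) (x : M) : TangentSpace J (f x) :=
  normalPart I f x (covAlong D f (fun y => mfderiv I J f y (Y y)) x (X x))

/-- The normal connection: `∇^⊥_X V` is the normal component of `∇̄_X V`. -/
def normalCov (D : CovariantDerivative J F (fun x : N => TangentSpace J x)) (f : M → N)
    (X : Π x : M, TangentSpace I x) (V : Π x : M, TangentSpace J (f x)) (x : M) :
    TangentSpace J (f x) :=
  normalPart I f x (covAlong D f V x (X x))

/-- The covariant derivative of the second fundamental form,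
`(∇_X h)(Y, Z) = ∇^⊥_X (h(Y, Z)) - h(∇_X Y, Z) - h(Y, ∇_X Z)`,
with `D` the connection of `N` and `D'` the connection of `M`. -/
def covSecondFF (D : CovariantDerivative J F (fun x : N => TangentSpace J x))
    (D' : CovariantDerivative I E (fun x : M => TangentSpace I x)) (f : M → N)
    (X Y Z : Π x : M, TangentSpace I x) (x : M) : TangentSpace J (f x) :=
  normalCov D f X (secondFF D f Y Z) x
    - secondFF D f (fun y => D' Y y (X y)) Z x
    - secondFF D f Y (fun y => D' Z y (X y)) x

/-- The vector field `X` on `M` is smooth. -/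
def SmoothField (X : Π x : M, TangentSpace I x) : Prop :=
  ContMDiff I I.tangent ∞ (fun x => (⟨x, X x⟩ : TangentBundle I M))

/-- The second fundamental form is parallel: `∇h = 0`. -/
def IsParallelSecondFF (D : CovariantDerivative J F (fun x : N => TangentSpace J x))
    (D' : CovariantDerivative I E (fun x : M => TangentSpace I x)) (f : M → N) : Prop :=
  ∀ X Y Z : Π x : M, TangentSpace I x, SmoothField X → SmoothField Y → SmoothField Z →
    ∀ x, covSecondFF D D' f X Y Z x = 0

variable (I) in
/-- The submanifold is totally geodesic: `h = 0`. -/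
def IsTotallyGeodesic (D : CovariantDerivative J F (fun x : N => TangentSpace J x))
    (f : M → N) : Prop :=
  ∀ X Y : Π x : M, TangentSpace I x, SmoothField X → SmoothField Y →
    ∀ x, secondFF D f X Y x = 0

end Submanifold

end GenKenmotsu

end

/-! The engine is the ambient formula `cov_ξ`: on a generalized Kenmotsu manifold `∇̄_u ξᵢ = -φ² u =
u - ∑ⱼ ηʲ(u) ξⱼ` for every `i`. Write `A = ∇̄ξᵢ`. Closedness of `ηⁱ` makes `A` self-adjoint.
Normality gives `L_{ξᵢ} φ = 0`, and the equation for `dΦ`, contracted with `ξᵢ`, gives `L_{ξᵢ} Φ =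
2Φ`; together they force `A = id` on the image of `φ`. The `ξⱼ` commute and are orthonormal, which
forces `A ξⱼ = 0`. Image and span together exhaust the tangent space.

Along `M` the `ξⱼ` are tangent, so `∇̄_X ξᵢ` is tangent when `X` is. Hence `h(X, ξᵢ) = 0` and, by
the Gauss formula, `∇_X ξᵢ = X - ∑ⱼ ηʲ(X) ξⱼ`. In `(∇_X h)(Y, ξᵢ)` only `-h(Y, ∇_X ξᵢ)` survives,
and it equals `-h(X, Y)` because `h` kills every `ξⱼ`. Since `s ≥ 1`, some `ξᵢ` exists, so `∇h = 0`
gives `h = 0`; the converse is immediate.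

The remaining work concerns the pull-back connection `covAlong`, defined through a trivialization:
it restricts correctly, is metric and torsion-free, and these facts give symmetry of `h` and the
Gauss formula. -/

namespace GenKenmotsu

open VectorField Filter
open scoped Topology

/-! ### Lie brackets as commutators of derivations. -/

section Derivation

variable {E : Type*} [NormedAddCommGroup E] [NormedSpace ℝ E] [CompleteSpace E]
  {H : Type*} [TopologicalSpace H] {I : ModelWithCorners ℝ E H} [I.Boundaryless]
  {M : Type*} [TopologicalSpace M] [ChartedSpace H M] [IsManifold I ∞ M]
  {F : Type*} [NormedAddCommGroup F] [NormedSpace ℝ F]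

omit [CompleteSpace E] [I.Boundaryless] in
/-- In the chart at `x`, a vector field near `x` is the representative used to define the Lie
bracket. -/
lemma eventually_mfderiv_extChartAt_apply (X : Π x : M, TangentSpace I x) (x : M) :
    ∀ᶠ y in 𝓝 x, mfderiv I 𝓘(ℝ, E) (extChartAt I x) y (X y) =
      mpullbackWithin 𝓘(ℝ, E) I (extChartAt I x).symm X (Set.range I) (extChartAt I x y) := by
  have h := eventuallyEq_mpullback_mpullbackWithin_extChartAt (I := I) (s := Set.univ) (x := x) X
  rw [nhdsWithin_univ] at h
  filter_upwards [h, extChartAt_source_mem_nhds (I := I) x] with y hy hys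
  rw [hy, mpullback_apply]
  exact (isInvertible_mfderiv_extChartAt hys).self_apply_inverse _

lemma differentiableAt_mpullbackWithin_extChartAt {X : Π x : M, TangentSpace I x} {x : M}
    (hX : MDifferentiableAt I I.tangent (fun y => (⟨y, X y⟩ : TangentBundle I M)) x) :
    DifferentiableAt ℝ (mpullbackWithin 𝓘(ℝ, E) I (extChartAt I x).symm X (Set.range I))
      (extChartAt I x x) := by
  have h := MDifferentiableWithinAt.differentiableWithinAt_mpullbackWithin_vectorField
    (mdifferentiableWithinAt_univ.2 hX)
  rw [I.range_eq_univ] at h ⊢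
  rw [Set.preimage_univ, Set.inter_univ] at h
  exact differentiableWithinAt_univ.1 h

/-- The differentiation operator along `[X, Y]` is the commutator of the differentiation operators
along `X` and `Y`. -/
lemma mvfderiv_apply_mlieBracket {g : M → F} {x : M} (hg : ContMDiffAt I 𝓘(ℝ, F) 2 g x)
    {X Y : Π x : M, TangentSpace I x}
    (hX : MDifferentiableAt I I.tangent (fun y => (⟨y, X y⟩ : TangentBundle I M)) x)
    (hY : MDifferentiableAt I I.tangent (fun y => (⟨y, Y y⟩ : TangentBundle I M)) x) :
    mvfderiv I g x (mlieBracket I X Y x) =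
      mvfderiv I (fun y => mvfderiv I g y (Y y)) x (X x)
        - mvfderiv I (fun y => mvfderiv I g y (X y)) x (Y x) := by
  set φ := extChartAt I x with hφ
  set g' : E → F := g ∘ φ.symm with hg'
  have hgC : ContDiffAt ℝ 2 g' (φ x) := by
    have := (contMDiffAt_iff.1 hg).2
    rw [I.range_eq_univ, contDiffWithinAt_univ] at this
    exact this
  have hdiff : ∀ (k : E → F) (y : M), y ∈ φ.source → DifferentiableAt ℝ k (φ y) →
      ∀ v : TangentSpace I y, mvfderiv I (k ∘ φ) y v =
        fderiv ℝ k (φ y) (mfderiv I 𝓘(ℝ, E) φ y v) := by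
    intro k y hy hk v
    have hy' : y ∈ (chartAt H x).source := by simpa [hφ] using hy
    have h1 := mfderiv_comp_apply (I := I) (I' := 𝓘(ℝ, E)) (I'' := 𝓘(ℝ, F)) y
      hk.mdifferentiableAt (mdifferentiableAt_extChartAt hy') v
    have h2 : mfderiv 𝓘(ℝ, E) 𝓘(ℝ, F) k (φ y) = fderiv ℝ k (φ y) := mfderiv_eq_fderiv
    exact h1.trans (by rw [h2]; rfl)
  have hsrc : ∀ᶠ y in 𝓝 x, y ∈ φ.source := extChartAt_source_mem_nhds (I := I) x
  have hgd : ∀ᶠ y in 𝓝 x, DifferentiableAt ℝ g' (φ y) := by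
    have h1 : ∀ᶠ z in 𝓝 (φ x), ContDiffAt ℝ 2 g' z := hgC.eventually (by simp)
    filter_upwards [(continuousAt_extChartAt (I := I) x).eventually h1] with y hy
    exact hy.differentiableAt (by simp)
  have hgg : ∀ᶠ y in 𝓝 x, ∀ v : TangentSpace I y,
      mvfderiv I g y v = fderiv ℝ g' (φ y) (mfderiv I 𝓘(ℝ, E) φ y v) := by
    filter_upwards [hsrc, hgd] with y hy hd v
    rw [← hdiff g' y hy hd v]
    have : g =ᶠ[𝓝 y] g' ∘ φ := by
      filter_upwards [(isOpen_extChartAt_source (I := I) x).mem_nhds hy] with z hz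
      simp [hg', φ.left_inv hz]
    have h3 := this.mfderiv_eq (I := I) (I' := 𝓘(ℝ, F))
    exact congrArg (fun L : E →L[ℝ] F => L v) h3
  -- Both iterated derivatives are read in the chart at `x`, so the claim reduces to the identity in
  -- `E`, where symmetry of the second derivative of `g'` gives it.
  have key : ∀ X Y : Π x : M, TangentSpace I x,
      MDifferentiableAt I I.tangent (fun y => (⟨y, Y y⟩ : TangentBundle I M)) x →
      mvfderiv I (fun y => mvfderiv I g y (Y y)) x (X x) =
        fderiv ℝ (fun z => fderiv ℝ g' z
          (mpullbackWithin 𝓘(ℝ, E) I φ.symm Y (Set.range I) z)) (φ x)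
          (mpullbackWithin 𝓘(ℝ, E) I φ.symm X (Set.range I) (φ x)) := by
    intro X Y hY
    have hk : (fun y => mvfderiv I g y (Y y)) =ᶠ[𝓝 x]
        (fun z => fderiv ℝ g' z (mpullbackWithin 𝓘(ℝ, E) I φ.symm Y (Set.range I) z)) ∘ φ := by
      filter_upwards [hgg, eventually_mfderiv_extChartAt_apply Y x] with y h1 h2
      rw [h1, h2]; rfl
    have hkd : DifferentiableAt ℝ
        (fun z => fderiv ℝ g' z (mpullbackWithin 𝓘(ℝ, E) I φ.symm Y (Set.range I) z)) (φ x) :=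
      DifferentiableAt.clm_apply
        ((hgC.fderiv_right (m := 1) (by norm_num)).differentiableAt (by simp))
        (differentiableAt_mpullbackWithin_extChartAt hY)
    have h3 := hk.mfderiv_eq (I := I) (I' := 𝓘(ℝ, F))
    have h4 := hdiff _ x (mem_extChartAt_source x) hkd (X x)
    rw [(eventually_mfderiv_extChartAt_apply X x).self_of_nhds] at h4
    rw [← h4]
    exact congrArg (fun L : E →L[ℝ] F => L (X x)) h3
  rw [key X Y hY, key Y X hX]
  rw [← fderiv_apply_lieBracket hgC (by simp)
    (differentiableAt_mpullbackWithin_extChartAt hY)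
    (differentiableAt_mpullbackWithin_extChartAt hX)]
  rw [hgg.self_of_nhds, ← mlieBracketWithin_univ, mlieBracketWithin_apply]
  have h5 := (isInvertible_mfderiv_extChartAt (I := I) (mem_extChartAt_source (I := I) x))
  refine congrArg (fderiv ℝ g' (φ x)) ((h5.self_apply_inverse _).trans ?_)
  rw [I.range_eq_univ, Set.preimage_univ, Set.inter_univ]
  exact congrFun (lieBracketWithin_univ (E := E)) _

end Derivation

/-! ### Pointwise forms of the Levi-Civita axioms. -/

section LeviCivita

variable {F : Type*} [NormedAddCommGroup F] [NormedSpace ℝ F] [FiniteDimensional ℝ F]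
  {G : Type*} [TopologicalSpace G] {J : ModelWithCorners ℝ F G}
  {N : Type*} [TopologicalSpace N] [ChartedSpace G N] [IsManifold J ∞ N]
  [RiemannianBundle (fun x : N => TangentSpace J x)]
  [IsContMDiffRiemannianBundle J ∞ F (fun x : N => TangentSpace J x)]
  {D : CovariantDerivative J F (fun x : N => TangentSpace J x)}

lemma IsLeviCivita.mlieBracket_eq (hD : IsLeviCivita D) {X Y : Π x : N, TangentSpace J x} {x : N}
    (hX : MDifferentiableAt J J.tangent (fun y => (⟨y, X y⟩ : TangentBundle J N)) x)
    (hY : MDifferentiableAt J J.tangent (fun y => (⟨y, Y y⟩ : TangentBundle J N)) x) :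
    mlieBracket J X Y x = D Y x (X x) - D X x (Y x) :=
  (D.torsion_eq_zero_iff.1 hD.torsion_eq_zero hX hY).symm

lemma IsLeviCivita.mvfderiv_inner (hD : IsLeviCivita D) {Y Z : Π x : N, TangentSpace J x} {x : N}
    (hY : MDifferentiableAt J J.tangent (fun y => (⟨y, Y y⟩ : TangentBundle J N)) x)
    (hZ : MDifferentiableAt J J.tangent (fun y => (⟨y, Z y⟩ : TangentBundle J N)) x)
    (v : TangentSpace J x) :
    mvfderiv J (fun y => inner ℝ (Y y) (Z y)) x v =
      inner ℝ (D Y x v) (Z x) + inner ℝ (Y x) (D Z x v) := by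
  have h := hD.metric.mvfderiv_inner_eq
    (FiberBundle.extend F (E := fun x : N => TangentSpace J x) v) hY hZ
  simpa only [FiberBundle.extend_apply_self] using h

end LeviCivita

/-! ### The covariant derivative of `ξᵢ` on a generalized Kenmotsu manifold. -/

section Ambient

variable {n s : ℕ} {F : Type*} [NormedAddCommGroup F] [NormedSpace ℝ F]
  {G : Type*} [TopologicalSpace G] {J : ModelWithCorners ℝ F G}
  {N : Type*} [TopologicalSpace N] [ChartedSpace G N] [IsManifold J ∞ N]
  [RiemannianBundle (fun x : N => TangentSpace J x)]

namespace MetricFStructure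

section Algebra

variable (S : MetricFStructure n s J N) (x : N)

lemma η_eq_inner (i : Fin s) (u : TangentSpace J x) : S.η i x u = inner ℝ u (S.ξ i x) := by
  have h := S.metric_φ x u (S.ξ i x)
  simp only [S.φ_ξ, inner_zero_right, S.η_ξ, mul_ite, mul_one, mul_zero, Finset.sum_ite_eq',
    Finset.mem_univ, if_true] at h
  linarith

/-- Computing `φ³ u` as `φ²(φ u)` and as `φ(φ² u)` leaves `∑ⱼ ηʲ(φ u) ξⱼ = 0`. -/
lemma η_φ (i : Fin s) (u : TangentSpace J x) : S.η i x (S.φ x u) = 0 := by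
  have h1 := S.φ_φ x (S.φ x u)
  have h2 := congrArg (S.φ x) (S.φ_φ x u)
  simp only [map_add, map_neg, map_sum, map_smul, S.φ_ξ, smul_zero, Finset.sum_const_zero,
    add_zero] at h2
  rw [h2] at h1
  have h3 : ∑ j, S.η j x (S.φ x u) • S.ξ j x = 0 := by simpa using h1.symm
  have h4 := congrArg (S.η i x) h3
  simpa [S.η_ξ] using h4

lemma inner_φ_right (u v : TangentSpace J x) :
    inner ℝ u (S.φ x v) = -inner ℝ (S.φ x u) v := by
  have h := S.metric_φ x u (S.φ x v)
  simp only [S.φ_φ, S.η_φ, mul_zero, Finset.sum_const_zero, sub_zero, inner_add_right,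
    inner_neg_right, inner_sum, inner_smul_right, ← S.η_eq_inner, add_zero] at h
  exact h.symm

lemma eq_zero_of_φ_of_η {w : TangentSpace J x} (h : S.φ x w = 0) (h' : ∀ i, S.η i x w = 0) :
    w = 0 := by
  have h1 := S.φ_φ x w
  simpa [h, h'] using h1

end Algebra

variable {S : MetricFStructure n s J N} {x : N}

lemma contMDiffAt_φ (S : MetricFStructure n s J N) {X : Π x : N, TangentSpace J x}
    (hX : ContMDiffAt J J.tangent ∞ (fun y => (⟨y, X y⟩ : TangentBundle J N)) x) :
    ContMDiffAt J J.tangent ∞ (fun y => (⟨y, S.φ y (X y)⟩ : TangentBundle J N)) x :=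
  (S.smooth_φ x).clm_bundle_apply hX

lemma mdifferentiableAt_ξ (S : MetricFStructure n s J N) (i : Fin s) (x : N) :
    MDifferentiableAt J J.tangent (fun y => (⟨y, S.ξ i y⟩ : TangentBundle J N)) x :=
  (S.smooth_ξ i x).mdifferentiableAt (by simp)

namespace IsGeneralizedKenmotsu

lemma nijenhuis_eq_zero (hS : S.IsGeneralizedKenmotsu) {X Y : Π x : N, TangentSpace J x}
    (hX : ContMDiffAt J J.tangent ∞ (fun y => (⟨y, X y⟩ : TangentBundle J N)) x)
    (hY : ContMDiffAt J J.tangent ∞ (fun y => (⟨y, Y y⟩ : TangentBundle J N)) x) :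
    nijenhuis J S.φ X Y x = 0 := by
  have h := hS.normal x X Y hX hY
  simpa [hS.closed _ x X Y hX hY] using h

/-- When `ηʲ(X)` and `ηʲ(Y)` are constant, the bracket is the only term of `dηʲ(X, Y)` left. -/
lemma η_mlieBracket (hS : S.IsGeneralizedKenmotsu) (j : Fin s) {X Y : Π x : N, TangentSpace J x}
    (hX : ContMDiffAt J J.tangent ∞ (fun y => (⟨y, X y⟩ : TangentBundle J N)) x)
    (hY : ContMDiffAt J J.tangent ∞ (fun y => (⟨y, Y y⟩ : TangentBundle J N)) x)
    {a b : ℝ} (ha : ∀ y, S.η j y (X y) = a) (hb : ∀ y, S.η j y (Y y) = b) :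
    S.η j x (mlieBracket J X Y x) = 0 := by
  have h := hS.closed j x X Y hX hY
  simpa [extDerivOne, ha, hb, mvfderiv_const] using h

/-- This is `L_{ξᵢ} φ = 0`. As `φ ξᵢ = 0`, the Nijenhuis tensor at `(ξᵢ, Y)` shows that `φ` kills
the difference of the two sides; every `ηʲ` kills it too, and a vector killed by all of these is
zero. -/
lemma mlieBracket_ξ_φ (hS : S.IsGeneralizedKenmotsu) (i : Fin s) {Y : Π x : N, TangentSpace J x}
    (hY : ContMDiffAt J J.tangent ∞ (fun y => (⟨y, Y y⟩ : TangentBundle J N)) x) :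
    mlieBracket J (S.ξ i) (fun y => S.φ y (Y y)) x = S.φ x (mlieBracket J (S.ξ i) Y x) := by
  have h0 : (fun y => S.φ y (S.ξ i y)) = (0 : Π x : N, TangentSpace J x) :=
    funext fun y => S.φ_ξ y i
  have h := hS.nijenhuis_eq_zero (S.smooth_ξ i x) hY
  simp only [nijenhuis, h0, mlieBracket_zero_left, Pi.zero_apply, map_zero, add_zero,
    sub_zero] at h
  refine (sub_eq_zero.1 (S.eq_zero_of_φ_of_η x ?_ fun j => ?_)).symm
  · rw [map_sub, h]
  · rw [map_sub, S.η_φ, hS.η_mlieBracket j (S.smooth_ξ i x) (S.contMDiffAt_φ hY)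
      (fun y => S.η_ξ y j i) (fun y => S.η_φ y j (Y y)), sub_zero]

lemma mlieBracket_ξ_ξ (hS : S.IsGeneralizedKenmotsu) (i j : Fin s) (x : N) :
    mlieBracket J (S.ξ i) (S.ξ j) x = 0 := by
  refine S.eq_zero_of_φ_of_η x ?_ fun k => hS.η_mlieBracket k (S.smooth_ξ i x) (S.smooth_ξ j x)
    (fun y => S.η_ξ y k i) (fun y => S.η_ξ y k j)
  have h0 : (fun y => S.φ y (S.ξ j y)) = (0 : Π x : N, TangentSpace J x) :=
    funext fun y => S.φ_ξ y j
  rw [← hS.mlieBracket_ξ_φ i (S.smooth_ξ j x), h0, mlieBracket_zero_right]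
  rfl

variable [FiniteDimensional ℝ F] [IsContMDiffRiemannianBundle J ∞ F (fun x : N => TangentSpace J x)]
  {D : CovariantDerivative J F (fun x : N => TangentSpace J x)}

/-- For the torsion-free metric connection, `2 dηⁱ(X, Y) = g(Y, ∇_X ξᵢ) - g(X, ∇_Y ξᵢ)`, so
closedness is self-adjointness of `∇ξᵢ`. -/
lemma inner_cov_ξ_comm (hS : S.IsGeneralizedKenmotsu) (hD : IsLeviCivita D) (i : Fin s)
    (u w : TangentSpace J x) :
    inner ℝ (D (S.ξ i) x u) w = inner ℝ u (D (S.ξ i) x w) := by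
  have hX := FiberBundle.contMDiffAt_extend (k := ∞) J F (V := fun x : N => TangentSpace J x) u
  have hY := FiberBundle.contMDiffAt_extend (k := ∞) J F (V := fun x : N => TangentSpace J x) w
  have hX' := hX.mdifferentiableAt (by simp)
  have hY' := hY.mdifferentiableAt (by simp)
  have h := hS.closed i x _ _ hX hY
  simp only [extDerivOne, S.η_eq_inner] at h
  rw [hD.mvfderiv_inner hX' (S.mdifferentiableAt_ξ i x),
    hD.mvfderiv_inner hY' (S.mdifferentiableAt_ξ i x), hD.mlieBracket_eq hX' hY'] at h
  simp only [FiberBundle.extend_apply_self, inner_sub_left] at h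
  rw [real_inner_comm]
  linarith

/-- The identity for `dΦ(ξᵢ, X, Y)` becomes `g(∇_X ξᵢ, φY) + g(X, ∇_{φY} ξᵢ) = 2 g(X, φY)`, and
self-adjointness makes the two terms on the left equal. -/
lemma inner_cov_ξ_φ (hS : S.IsGeneralizedKenmotsu) (hD : IsLeviCivita D) (i : Fin s)
    (u w : TangentSpace J x) :
    inner ℝ (D (S.ξ i) x u) (S.φ x w) = inner ℝ u (S.φ x w) := by
  have hX := FiberBundle.contMDiffAt_extend (k := ∞) J F (V := fun x : N => TangentSpace J x) u
  have hY := FiberBundle.contMDiffAt_extend (k := ∞) J F (V := fun x : N => TangentSpace J x) w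
  have hu := FiberBundle.extend_apply_self F (E := fun x : N => TangentSpace J x) u
  have hw := FiberBundle.extend_apply_self F (E := fun x : N => TangentSpace J x) w
  set X := FiberBundle.extend F (E := fun x : N => TangentSpace J x) u
  set Y := FiberBundle.extend F (E := fun x : N => TangentSpace J x) w
  have hφY := S.contMDiffAt_φ hY
  have hξ := S.mdifferentiableAt_ξ i x
  have hX' := hX.mdifferentiableAt (by simp)
  have hY' := hY.mdifferentiableAt (by simp)
  have hφY' := hφY.mdifferentiableAt (by simp)
  have h := hS.dΦ_eq x (S.ξ i) X Y (S.smooth_ξ i x) hX hY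
  have e1 : (fun y => S.Φ y (Y y) (S.ξ i y)) = fun _ => 0 := by
    funext y; simp [Φ, S.φ_ξ]
  have e2 : (fun y => S.Φ y (S.ξ i y) (X y)) = fun _ => 0 := by
    funext y; rw [Φ, real_inner_comm, ← S.η_eq_inner, S.η_φ]
  have e3 : mvfderiv J (fun y => S.Φ y (X y) (Y y)) x (S.ξ i x) =
      inner ℝ (D X x (S.ξ i x)) (S.φ x (Y x))
        + inner ℝ (X x) (D (fun y => S.φ y (Y y)) x (S.ξ i x)) :=
    hD.mvfderiv_inner hX' hφY' _
  -- Two signs cancel: one from skewness of `φ`, one from swapping the bracket.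
  have e4 : S.Φ x (mlieBracket J Y (S.ξ i) x) (X x) =
      inner ℝ (mlieBracket J (S.ξ i) (fun y => S.φ y (Y y)) x) (X x) := by
    rw [hS.mlieBracket_ξ_φ i hY, Φ, S.inner_φ_right, mlieBracket_swap_apply, map_neg,
      inner_neg_left, neg_neg]
  have e5 : ∀ v, S.Φ x v (S.ξ i x) = 0 := fun v => by simp [Φ, S.φ_ξ]
  have e6 : ∀ v, S.Φ x (S.ξ i x) v = 0 := fun v => by
    rw [Φ, real_inner_comm, ← S.η_eq_inner, S.η_φ]
  simp only [extDerivTwo, wedgeOneTwo, e1, e2, e3, e4, e5, e6, mvfderiv_const, S.η_ξ] at h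
  -- Once the brackets are expanded, the derivatives in the direction `ξᵢ` cancel those in `e3`.
  simp only [hD.mlieBracket_eq hξ hφY', hD.mlieBracket_eq hξ hX', Φ, inner_sub_left,
    zero_apply, mul_zero, add_zero, sub_zero, ite_mul, one_mul, zero_mul,
    mul_ite, Finset.sum_ite_eq', Finset.mem_univ, if_true] at h
  rw [hu, hw] at h
  rw [real_inner_comm u (D (fun y => S.φ y (Y y)) x (S.ξ i x)),
    real_inner_comm u (D (S.ξ i) x (S.φ x w)), ← hS.inner_cov_ξ_comm hD i] at h
  linarith

/-- The trilinear expression is symmetric in `j, k` by self-adjointness and in `i, j` because the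
`ξ`'s commute, hence totally symmetric; constancy of `g(ξᵢ, ξₖ)` makes it antisymmetric in `i, k`.
-/
lemma inner_cov_ξ_ξ (hS : S.IsGeneralizedKenmotsu) (hD : IsLeviCivita D) (i j k : Fin s) (x : N) :
    inner ℝ (D (S.ξ i) x (S.ξ j x)) (S.ξ k x) = 0 := by
  have h1 : ∀ i j k, (inner ℝ (D (S.ξ i) x (S.ξ j x)) (S.ξ k x) : ℝ) =
      inner ℝ (D (S.ξ i) x (S.ξ k x)) (S.ξ j x) := fun i j k => by
    rw [hS.inner_cov_ξ_comm hD, real_inner_comm]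
  have h2 : ∀ i j k, (inner ℝ (D (S.ξ i) x (S.ξ j x)) (S.ξ k x) : ℝ) =
      inner ℝ (D (S.ξ j) x (S.ξ i x)) (S.ξ k x) := fun i j k => by
    have h := hS.mlieBracket_ξ_ξ j i x
    rw [hD.mlieBracket_eq (S.mdifferentiableAt_ξ j x) (S.mdifferentiableAt_ξ i x),
      sub_eq_zero] at h
    rw [h]
  have h3 : (inner ℝ (D (S.ξ i) x (S.ξ j x)) (S.ξ k x) : ℝ) +
      inner ℝ (D (S.ξ k) x (S.ξ j x)) (S.ξ i x) = 0 := by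
    rw [real_inner_comm (S.ξ i x), ← hD.mvfderiv_inner (S.mdifferentiableAt_ξ i x)
      (S.mdifferentiableAt_ξ k x)]
    simp only [← S.η_eq_inner, S.η_ξ, mvfderiv_const, zero_apply]
  have h4 := h2 k j i
  have h5 := h1 j k i
  have h6 := h2 i j k
  linarith

/-- In a generalized Kenmotsu manifold, `∇_u ξᵢ = -φ² u`. -/
theorem cov_ξ (hS : S.IsGeneralizedKenmotsu) (hD : IsLeviCivita D) (i : Fin s)
    (u : TangentSpace J x) :
    D (S.ξ i) x u = u - ∑ j, S.η j x u • S.ξ j x := by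
  -- As `u = -φ² u + ∑ⱼ ηʲ(u) ξⱼ`, it suffices to know `∇ξᵢ` on the image of `φ` and on each `ξⱼ`.
  have hφ : ∀ w, D (S.ξ i) x (S.φ x w) = S.φ x w := fun w => ext_inner_left ℝ fun v => by
    rw [← hS.inner_cov_ξ_comm hD, hS.inner_cov_ξ_φ hD]
  have hξ : ∀ j, D (S.ξ i) x (S.ξ j x) = 0 := fun j => by
    refine S.eq_zero_of_φ_of_η x ?_ fun k => ?_
    · refine ext_inner_left ℝ fun v => ?_
      rw [S.inner_φ_right, real_inner_comm, hS.inner_cov_ξ_φ hD, real_inner_comm,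
        ← S.η_eq_inner, S.η_φ]
      simp
    · rw [S.η_eq_inner, hS.inner_cov_ξ_ξ hD]
  have h := S.φ_φ x u
  have h1 : D (S.ξ i) x (S.φ x (S.φ x u)) = -D (S.ξ i) x u := by
    rw [h, map_add, map_neg, map_sum]
    simp [hξ]
  rw [hφ, h] at h1
  rw [eq_comm, ← neg_inj, ← h1]
  abel

end IsGeneralizedKenmotsu

end MetricFStructure

end Ambient

/-! ### Coordinate frames in a trivialization of the tangent bundle. -/

section Frame

variable {F : Type*} [NormedAddCommGroup F] [NormedSpace ℝ F]
  {G : Type*} [TopologicalSpace G] (J : ModelWithCorners ℝ F G)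
  {N : Type*} [TopologicalSpace N] [ChartedSpace G N] [IsManifold J ∞ N]

/-- The vector field around `p` whose components in the trivialization at `p` are the constant
vector `c`. -/
noncomputable def frameField (p : N) (c : F) (z : N) : TangentSpace J z :=
  (trivializationAt F (TangentSpace J : N → Type _) p).symmL ℝ z c

/-- The components of a tangent vector in the trivialization at `p`. -/
noncomputable def coords (p : N) {z : N} (v : TangentSpace J z) : F :=
  (trivializationAt F (TangentSpace J : N → Type _) p (⟨z, v⟩ : TangentBundle J N)).2

variable {J} {p z : N}

lemma coords_frameField (hz : z ∈ (chartAt G p).source) (c : F) :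
    coords J p (frameField J p c z) = c := by
  have hz' : z ∈ (trivializationAt F (TangentSpace J : N → Type _) p).baseSet := hz
  have h := (trivializationAt F (TangentSpace J : N → Type _) p).continuousLinearMapAt_symmL
    (R := ℝ) hz' c
  rwa [Trivialization.continuousLinearMapAt_apply_of_mem ℝ _ hz'] at h

lemma frameField_coords (hz : z ∈ (chartAt G p).source) (v : TangentSpace J z) :
    frameField J p (coords J p v) z = v := by
  have hz' : z ∈ (trivializationAt F (TangentSpace J : N → Type _) p).baseSet := hz
  have h := (trivializationAt F (TangentSpace J : N → Type _) p).symmL_continuousLinearMapAt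
    (R := ℝ) hz' v
  rwa [Trivialization.continuousLinearMapAt_apply_of_mem ℝ _ hz'] at h

/-- The trivialization at `p` is the derivative of the chart at `p`; this makes the frame fields
coordinate fields. -/
lemma coords_eq_mvfderiv (hz : z ∈ (chartAt G p).source) (v : TangentSpace J z) :
    coords J p v = mvfderiv J (extChartAt J p) z v := by
  have hz' : z ∈ (trivializationAt F (TangentSpace J : N → Type _) p).baseSet := hz
  have h := congrArg (fun L : TangentSpace J z →L[ℝ] F => L v)
    (TangentBundle.continuousLinearMapAt_trivializationAt (I := J) hz)
  refine Eq.trans ?_ h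
  exact (Trivialization.continuousLinearMapAt_apply_of_mem ℝ _ hz' v).symm

lemma coords_add (hz : z ∈ (chartAt G p).source) (u v : TangentSpace J z) :
    coords J p (u + v) = coords J p u + coords J p v := by
  simp only [coords_eq_mvfderiv hz, map_add]

lemma coords_smul (hz : z ∈ (chartAt G p).source) (a : ℝ) (v : TangentSpace J z) :
    coords J p (a • v) = a • coords J p v := by
  simp only [coords_eq_mvfderiv hz, map_smul]

lemma frameField_add (p : N) (c d : F) :
    frameField J p (c + d) = frameField J p c + frameField J p d :=
  funext fun z => map_add ((trivializationAt F (TangentSpace J : N → Type _) p).symmL ℝ z) c d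

lemma frameField_smul (p : N) (a : ℝ) (c : F) :
    frameField J p (a • c) = a • frameField J p c :=
  funext fun z => map_smul ((trivializationAt F (TangentSpace J : N → Type _) p).symmL ℝ z) a c

lemma mdifferentiableAt_frameField (p : N) (c : F) :
    MDifferentiableAt J J.tangent (fun y => (⟨y, frameField J p c y⟩ : TangentBundle J N)) p := by
  rw [mdifferentiableAt_section]
  refine (mdifferentiableAt_const (c := c)).congr_of_eventuallyEq ?_
  filter_upwards [(chartAt G p).open_source.mem_nhds (mem_chart_source G p)] with y hy
  exact coords_frameField hy c

variable [CompleteSpace F] [J.Boundaryless]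

/-- Frame fields differentiate the chart map to constants, so their commutator annihilates it, and
the chart map has injective derivative. -/
lemma mlieBracket_frameField (p : N) (c d : F) :
    mlieBracket J (frameField J p c) (frameField J p d) p = 0 := by
  have hp := mem_chart_source G p
  have hconst : ∀ c : F, (fun y => mvfderiv J (extChartAt J p) y (frameField J p c y)) =ᶠ[𝓝 p]
      fun _ => c := fun c => by
    filter_upwards [(chartAt G p).open_source.mem_nhds hp] with y hy
    rw [← coords_eq_mvfderiv hy, coords_frameField hy]
  have h := mvfderiv_apply_mlieBracket (I := J) (g := extChartAt J p) (x := p)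
    (contMDiffAt_extChartAt.of_le (by exact_mod_cast le_top))
    (mdifferentiableAt_frameField p c) (mdifferentiableAt_frameField p d)
  have h0 : ∀ c : F, mvfderiv J
      (fun y => mvfderiv J (extChartAt J p) y (frameField J p c y)) p = 0 := fun c => by
    refine Eq.trans ?_ (mvfderiv_const (I := J) c (x := p))
    exact (hconst c).mfderiv_eq
  rw [h0, h0, ← coords_eq_mvfderiv hp] at h
  rw [← frameField_coords hp (mlieBracket J _ _ p), h]
  simp [frameField]

end Frame

/-! ### The pull-back connection on restrictions of ambient fields. -/

section Along

variable {E : Type*} [NormedAddCommGroup E] [NormedSpace ℝ E]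
  {H : Type*} [TopologicalSpace H] {I : ModelWithCorners ℝ E H}
  {M : Type*} [TopologicalSpace M] [ChartedSpace H M]
  {F : Type*} [NormedAddCommGroup F] [NormedSpace ℝ F]
  {G : Type*} [TopologicalSpace G] {J : ModelWithCorners ℝ F G}
  {N : Type*} [TopologicalSpace N] [ChartedSpace G N] [IsManifold J ∞ N]
  {D : CovariantDerivative J F (fun x : N => TangentSpace J x)} {f : M → N} {x : M}

lemma covAlong_apply (V : Π x : M, TangentSpace J (f x)) (v : TangentSpace I x) :
    covAlong D f V x v =
      frameField J (f x) (mvfderiv I (fun y => coords J (f x) (V y)) x v) (f x)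
        + D (frameField J (f x) (coords J (f x) (V x))) (f x) (mfderiv I J f x v) :=
  rfl

variable [FiniteDimensional ℝ F]

/-- The difference of the two sides is tensorial in `ξ`: the Leibniz terms cancel. So `ξ` may be
replaced by the frame field with the same value at `p`, for which the difference vanishes. -/
lemma cov_eq_frame {p : N} {ξ : Π z : N, TangentSpace J z}
    (hξ : MDifferentiableAt J J.tangent (fun y => (⟨y, ξ y⟩ : TangentBundle J N)) p)
    (u : TangentSpace J p) :
    D ξ p u = frameField J p (mvfderiv J (fun z => coords J p (ξ z)) p u) p
      + D (frameField J p (coords J p (ξ p))) p u := by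
  have hp := mem_chart_source G p
  have hev : ∀ᶠ z in 𝓝 p, z ∈ (chartAt G p).source := (chartAt G p).open_source.mem_nhds hp
  have hc : ∀ {σ : Π z : N, TangentSpace J z},
      MDifferentiableAt J J.tangent (fun y => (⟨y, σ y⟩ : TangentBundle J N)) p →
      MDifferentiableAt J 𝓘(ℝ, F) (fun z => coords J p (σ z)) p :=
    fun h => (mdifferentiableAt_section _ _).1 h
  have hT : TensorialAt J F (fun ξ : Π z : N, TangentSpace J z =>
      D ξ p u - frameField J p (mvfderiv J (fun z => coords J p (ξ z)) p u) p
        - D (frameField J p (coords J p (ξ p))) p u) p := by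
    constructor
    · intro g σ hg hσ
      have h1 : mvfderiv J (fun z => coords J p ((g • σ) z)) p =
          mvfderiv J (fun z => g z • coords J p (σ z)) p :=
        EventuallyEq.mfderiv_eq (by
          filter_upwards [hev] with z hz using coords_smul hz (g z) (σ z))
      have h2 : coords J p ((g • σ) p) = g p • coords J p (σ p) := coords_smul hp _ _
      rw [h1, h2, mvfderiv_fun_smul hg (hc hσ), frameField_smul,
        D.isCovariantDerivativeOnUniv.smul_const _ (mdifferentiableAt_frameField p _),
        D.isCovariantDerivativeOnUniv.leibniz hσ hg]
      simp only [add_apply, smul_apply,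
        ContinuousLinearMap.smulRight_apply, frameField_add, frameField_smul, Pi.add_apply,
        Pi.smul_apply, frameField_coords hp]
      module
    · intro σ σ' hσ hσ'
      have h1 : mvfderiv J (fun z => coords J p ((σ + σ') z)) p =
          mvfderiv J (fun z => coords J p (σ z) + coords J p (σ' z)) p :=
        EventuallyEq.mfderiv_eq (by
          filter_upwards [hev] with z hz using coords_add hz (σ z) (σ' z))
      have h2 : coords J p ((σ + σ') p) = coords J p (σ p) + coords J p (σ' p) :=
        coords_add hp _ _
      rw [h1, h2, mvfderiv_fun_add (hc hσ) (hc hσ'), frameField_add,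
        D.isCovariantDerivativeOnUniv.add (mdifferentiableAt_frameField p _)
          (mdifferentiableAt_frameField p _), D.isCovariantDerivativeOnUniv.add hσ hσ']
      simp only [add_apply, frameField_add, Pi.add_apply]
      module
  have h := hT.pointwise hξ (mdifferentiableAt_frameField p (coords J p (ξ p)))
    (frameField_coords hp (ξ p)).symm
  have h0 : mvfderiv J (fun z => coords J p (frameField J p (coords J p (ξ p)) z)) p = 0 := by
    refine Eq.trans ?_ (mvfderiv_const (I := J) (coords J p (ξ p)) (x := p))
    exact EventuallyEq.mfderiv_eq (by
      filter_upwards [hev] with z hz using coords_frameField hz _)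
  simp only [h0, frameField_coords hp] at h
  simp only [zero_apply, frameField, map_zero, sub_zero, sub_self] at h ⊢
  rw [sub_sub, sub_eq_zero] at h
  exact h

/-- The pull-back connection on the restriction of a vector field of `N`. -/
lemma covAlong_comp {ξ : Π z : N, TangentSpace J z}
    (hξ : MDifferentiableAt J J.tangent (fun y => (⟨y, ξ y⟩ : TangentBundle J N)) (f x))
    (hf : MDifferentiableAt I J f x) (v : TangentSpace I x) :
    covAlong D f (fun y => ξ (f y)) x v = D ξ (f x) (mfderiv I J f x v) := by
  rw [covAlong_apply, cov_eq_frame hξ]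
  congr 2
  exact mfderiv_comp_apply (I'' := 𝓘(ℝ, F)) x ((mdifferentiableAt_section _ _).1 hξ) hf v

lemma covAlong_zero (hf : MDifferentiableAt I J f x) (v : TangentSpace I x) :
    covAlong D f (fun y => (0 : TangentSpace J (f y))) x v = 0 := by
  refine (covAlong_comp (ξ := 0) (mdifferentiable_zeroSection _ _ _) hf v).trans ?_
  rw [D.zero]
  rfl

end Along

/-! ### Derivatives of finite sums and of linear images. -/

section Sum

variable {E : Type*} [NormedAddCommGroup E] [NormedSpace ℝ E]
  {H : Type*} [TopologicalSpace H] {I : ModelWithCorners ℝ E H}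
  {M : Type*} [TopologicalSpace M] [ChartedSpace H M] {x : M}
  {F : Type*} [NormedAddCommGroup F] [NormedSpace ℝ F]

lemma mvfderiv_fun_sum {ι : Type*} {s : Finset ι} {g : ι → M → F}
    (hg : ∀ i ∈ s, MDifferentiableAt I 𝓘(ℝ, F) (g i) x) :
    MDifferentiableAt I 𝓘(ℝ, F) (fun y => ∑ i ∈ s, g i y) x ∧
      mvfderiv I (fun y => ∑ i ∈ s, g i y) x = ∑ i ∈ s, mvfderiv I (g i) x := by
  classical
  induction s using Finset.induction_on with
  | empty => exact ⟨by simpa using mdifferentiableAt_const, by simpa using mvfderiv_const 0⟩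
  | insert a s ha ih =>
    simp only [Finset.sum_insert ha]
    have h1 := hg a (Finset.mem_insert_self a s)
    have h2 := ih fun i hi => hg i (Finset.mem_insert_of_mem hi)
    exact ⟨h1.add h2.1, by rw [mvfderiv_fun_add h1 h2.1, h2.2]⟩

lemma mvfderiv_clm_comp {F' : Type*} [NormedAddCommGroup F'] [NormedSpace ℝ F'] (L : F →L[ℝ] F')
    {c : M → F} (hc : MDifferentiableAt I 𝓘(ℝ, F) c x) (v : TangentSpace I x) :
    mvfderiv I (fun y => L (c y)) x v = L (mvfderiv I c x v) := by
  have h := mfderiv_comp_apply (I := I) (I' := 𝓘(ℝ, F)) (I'' := 𝓘(ℝ, F')) x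
    L.differentiableAt.mdifferentiableAt hc v
  refine h.trans ?_
  have h2 : mfderiv 𝓘(ℝ, F) 𝓘(ℝ, F') L (c x) = L := by
    rw [mfderiv_eq_fderiv, L.fderiv]
  rw [h2]
  rfl

end Sum

/-! ### Metric compatibility and torsion-freeness of the pull-back connection. -/

section Along

variable {E : Type*} [NormedAddCommGroup E] [NormedSpace ℝ E]
  {H : Type*} [TopologicalSpace H] {I : ModelWithCorners ℝ E H}
  {M : Type*} [TopologicalSpace M] [ChartedSpace H M]
  {F : Type*} [NormedAddCommGroup F] [NormedSpace ℝ F] [FiniteDimensional ℝ F]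
  {G : Type*} [TopologicalSpace G] {J : ModelWithCorners ℝ F G}
  {N : Type*} [TopologicalSpace N] [ChartedSpace G N] [IsManifold J ∞ N]
  {D : CovariantDerivative J F (fun x : N => TangentSpace J x)} {f : M → N} {x : M}

/-- The `a`-th component, in the trivialization at `f x`, of a vector field along `f`. -/
noncomputable def component {ι : Type*} (b : Module.Basis ι ℝ F)
    (V : Π y : M, TangentSpace J (f y)) (x : M) (a : ι) (y : M) : ℝ :=
  LinearMap.toContinuousLinearMap (b.coord a) (coords J (f x) (V y))

variable {ι : Type*} [Fintype ι] (b : Module.Basis ι ℝ F) {V W : Π y : M, TangentSpace J (f y)}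

omit [Fintype ι] in
lemma mdifferentiableAt_component
    (hV : MDifferentiableAt I J.tangent (fun y => (⟨f y, V y⟩ : TangentBundle J N)) x) (a : ι) :
    MDifferentiableAt I 𝓘(ℝ) (component b V x a) x :=
  (ContinuousLinearMap.differentiableAt _).mdifferentiableAt.comp x
    ((mdifferentiableAt_totalSpace _ _).1 hV).2

omit [TopologicalSpace M] in
lemma sum_component_smul {y : M} (hy : f y ∈ (chartAt G (f x)).source) :
    ∑ a, component b V x a y • frameField J (f x) (b a) (f y) = V y := by
  have h := congrArg (fun c => frameField J (f x) c (f y)) (b.sum_repr (coords J (f x) (V y)))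
  simp only [frameField_coords hy] at h
  refine Eq.trans ?_ h
  simp only [frameField, component, map_sum, map_smul]
  rfl

lemma covAlong_eq_sum
    (hV : MDifferentiableAt I J.tangent (fun y => (⟨f y, V y⟩ : TangentBundle J N)) x)
    (v : TangentSpace I x) :
    covAlong D f V x v =
      ∑ a, (mvfderiv I (component b V x a) x v • frameField J (f x) (b a) (f x)
        + component b V x a x • D (frameField J (f x) (b a)) (f x) (mfderiv I J f x v)) := by
  have hlin : ∀ c : F, D (frameField J (f x) c) (f x) (mfderiv I J f x v) =
      ∑ a, b.repr c a • D (frameField J (f x) (b a)) (f x) (mfderiv I J f x v) := by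
    let L : F →ₗ[ℝ] TangentSpace J (f x) :=
      { toFun := fun c => D (frameField J (f x) c) (f x) (mfderiv I J f x v)
        map_add' := fun c d => by
          rw [frameField_add, D.isCovariantDerivativeOnUniv.add (mdifferentiableAt_frameField _ c)
            (mdifferentiableAt_frameField _ d), add_apply]
        map_smul' := fun r c => by
          rw [frameField_smul, D.isCovariantDerivativeOnUniv.smul_const r
            (mdifferentiableAt_frameField _ c), smul_apply, RingHom.id_apply] }
    intro c
    have h := congrArg L (b.sum_repr c)
    rw [map_sum] at h
    simp only [map_smul] at h
    exact h.symm
  rw [covAlong_apply, hlin, Finset.sum_add_distrib]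
  congr 1
  have h := congrArg (fun c => frameField J (f x) c (f x))
    (b.sum_repr (mvfderiv I (fun y => coords J (f x) (V y)) x v))
  rw [← h]
  simp only [frameField, map_sum, map_smul]
  refine Finset.sum_congr rfl fun a _ => ?_
  congr 1
  exact (mvfderiv_clm_comp (LinearMap.toContinuousLinearMap (b.coord a))
    ((mdifferentiableAt_totalSpace _ _).1 hV).2 v).symm

/-- The pull-back of the Levi-Civita connection is compatible with the metric. -/
lemma IsLeviCivita.mvfderiv_inner_along [RiemannianBundle (fun x : N => TangentSpace J x)]
    [IsContMDiffRiemannianBundle J ∞ F (fun x : N => TangentSpace J x)] (hD : IsLeviCivita D)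
    (hV : MDifferentiableAt I J.tangent (fun y => (⟨f y, V y⟩ : TangentBundle J N)) x)
    (hW : MDifferentiableAt I J.tangent (fun y => (⟨f y, W y⟩ : TangentBundle J N)) x)
    (v : TangentSpace I x) :
    mvfderiv I (fun y => inner ℝ (V y) (W y)) x v =
      inner ℝ (covAlong D f V x v) (W x) + inner ℝ (V x) (covAlong D f W x v) := by
  let b := Module.finBasis ℝ F
  have hf : MDifferentiableAt I J f x := ((mdifferentiableAt_totalSpace _ _).1 hV).1
  have hx := mem_chart_source G (f x)
  -- Gram functions of the frame live on `N`, where metric compatibility of `D` applies; the product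
  -- rule for components does the rest.
  let g : Fin (Module.finrank ℝ F) → Fin (Module.finrank ℝ F) → N → ℝ := fun i j z =>
    inner ℝ (frameField J (f x) (b i) z) (frameField J (f x) (b j) z)
  have hgd : ∀ i j, MDifferentiableAt J 𝓘(ℝ) (g i j) (f x) := fun i j =>
    MDifferentiableAt.inner_bundle (IB := J) (F := F) (E := fun z : N => TangentSpace J z)
      (b := fun z => z) (mdifferentiableAt_frameField _ (b i)) (mdifferentiableAt_frameField _ (b j))
  have hg : ∀ i j, mvfderiv I (fun y => g i j (f y)) x v =
      inner ℝ (D (frameField J (f x) (b i)) (f x) (mfderiv I J f x v))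
          (frameField J (f x) (b j) (f x))
        + inner ℝ (frameField J (f x) (b i) (f x))
          (D (frameField J (f x) (b j)) (f x) (mfderiv I J f x v)) := fun i j => by
    rw [← hD.mvfderiv_inner (mdifferentiableAt_frameField _ (b i))
      (mdifferentiableAt_frameField _ (b j))]
    exact mfderiv_comp_apply (I'' := 𝓘(ℝ)) x (hgd i j) hf v
  have hev : (fun y => inner ℝ (V y) (W y)) =ᶠ[𝓝 x] fun y => ∑ i, ∑ j,
      component b V x i y * (component b W x j y * g i j (f y)) := by
    filter_upwards [hf.continuousAt.eventually ((chartAt G (f x)).open_source.mem_nhds hx)]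
      with y hy
    rw [← sum_component_smul b (V := V) hy, ← sum_component_smul b (V := W) hy]
    simp only [sum_inner, inner_sum, inner_smul_left, inner_smul_right, g]
    rw [Finset.sum_comm]
    refine Finset.sum_congr rfl fun j _ => ?_
    rw [Finset.mul_sum]
    refine Finset.sum_congr rfl fun i _ => ?_
    simp only [conj_trivial]
    ring
  have hdV := mdifferentiableAt_component b hV
  have hdW := mdifferentiableAt_component b hW
  have hdg : ∀ i j, MDifferentiableAt I 𝓘(ℝ) (fun y => g i j (f y)) x := fun i j =>
    (hgd i j).comp x hf
  have hWg : ∀ i j, MDifferentiableAt I 𝓘(ℝ) (fun y => component b W x j y * g i j (f y)) x :=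
    fun i j => (hdW j).mul (hdg i j)
  have hVWg : ∀ i j, MDifferentiableAt I 𝓘(ℝ)
      (fun y => component b V x i y * (component b W x j y * g i j (f y))) x :=
    fun i j => (hdV i).mul (hWg i j)
  have e1 : mvfderiv I (fun y => inner ℝ (V y) (W y)) x = mvfderiv I (fun y => ∑ i, ∑ j,
      component b V x i y * (component b W x j y * g i j (f y))) x := hev.mfderiv_eq
  have e2 : ∀ i, mvfderiv I (fun y => ∑ j,
      component b V x i y * (component b W x j y * g i j (f y))) x v =
      ∑ j, (component b V x i x * (component b W x j x * mvfderiv I (fun y => g i j (f y)) x v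
        + g i j (f x) * mvfderiv I (component b W x j) x v)
        + component b W x j x * g i j (f x) * mvfderiv I (component b V x i) x v) := fun i => by
    rw [(mvfderiv_fun_sum fun j _ => hVWg i j).2, FunLike.coe_sum, Finset.sum_apply]
    refine Finset.sum_congr rfl fun j _ => ?_
    rw [mvfderiv_fun_mul (hdV i) (hWg i j), mvfderiv_fun_mul (hdW j) (hdg i j)]
    simp only [add_apply, smul_apply, smul_eq_mul]
  rw [e1, (mvfderiv_fun_sum fun i _ => (mvfderiv_fun_sum fun j _ => hVWg i j).1).2,
    covAlong_eq_sum b hV, covAlong_eq_sum b hW, ← sum_component_smul b (V := V) hx,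
    ← sum_component_smul b (V := W) hx]
  rw [FunLike.coe_sum, Finset.sum_apply]
  simp only [e2, hg, sum_inner, inner_sum, inner_smul_left, inner_smul_right, inner_add_left,
    inner_add_right, conj_trivial]
  rw [Finset.sum_comm, ← Finset.sum_add_distrib]
  refine Finset.sum_congr rfl fun j _ => ?_
  simp only [Finset.mul_sum, ← Finset.sum_add_distrib]
  refine Finset.sum_congr rfl fun i _ => ?_
  simp only [g]
  ring

variable [CompleteSpace E] [I.Boundaryless] [J.Boundaryless] [IsManifold I ∞ M]

/-- The pull-back of the Levi-Civita connection is torsion-free. -/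
lemma IsLeviCivita.covAlong_mfderiv_sub [RiemannianBundle (fun x : N => TangentSpace J x)]
    [IsContMDiffRiemannianBundle J ∞ F (fun x : N => TangentSpace J x)] (hD : IsLeviCivita D)
    (hf : ContMDiff I J ∞ f) {X Y : Π x : M, TangentSpace I x}
    (hX : MDifferentiableAt I I.tangent (fun y => (⟨y, X y⟩ : TangentBundle I M)) x)
    (hY : MDifferentiableAt I I.tangent (fun y => (⟨y, Y y⟩ : TangentBundle I M)) x) :
    covAlong D f (fun y => mfderiv I J f y (Y y)) x (X x)
        - covAlong D f (fun y => mfderiv I J f y (X y)) x (Y x) =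
      mfderiv I J f x (mlieBracket I X Y x) := by
  have hx := mem_chart_source G (f x)
  have hfd : MDifferentiable I J f := hf.mdifferentiable (by simp)
  have hψ : ContMDiffAt J 𝓘(ℝ, F) ∞ (extChartAt J (f x)) (f x) := contMDiffAt_extChartAt
  -- The components of `df(X)` are the derivatives of the chart expression of `f` along `X`, so the
  -- derivative terms differ by the commutator formula.
  have hcoord : ∀ y, f y ∈ (chartAt G (f x)).source → ∀ v : TangentSpace I y,
      coords J (f x) (mfderiv I J f y v) = mvfderiv I (extChartAt J (f x) ∘ f) y v := by
    intro y hy v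
    rw [coords_eq_mvfderiv hy]
    exact (mfderiv_comp_apply (I'' := 𝓘(ℝ, F)) y (mdifferentiableAt_extChartAt hy) (hfd y) v).symm
  have hcoord' : ∀ X : Π x : M, TangentSpace I x,
      mvfderiv I (fun y => coords J (f x) (mfderiv I J f y (X y))) x =
        mvfderiv I (fun y => mvfderiv I (extChartAt J (f x) ∘ f) y (X y)) x := fun X =>
    EventuallyEq.mfderiv_eq (by
      filter_upwards [(hfd x).continuousAt.eventually
        ((chartAt G (f x)).open_source.mem_nhds hx)] with y hy using hcoord y hy (X y))
  have h1 := mvfderiv_apply_mlieBracket (I := I) (g := extChartAt J (f x) ∘ f) (x := x)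
    ((hψ.comp x (hf x)).of_le (WithTop.coe_le_coe.2 (le_top : (2 : ℕ∞) ≤ ⊤))) hX hY
  -- The frozen fields commute, so torsion-freeness of `D` cancels the two connection terms.
  have h2 := hD.mlieBracket_eq
    (mdifferentiableAt_frameField (J := J) (f x) (coords J (f x) (mfderiv I J f x (X x))))
    (mdifferentiableAt_frameField (J := J) (f x) (coords J (f x) (mfderiv I J f x (Y x))))
  rw [mlieBracket_frameField, frameField_coords hx, frameField_coords hx] at h2
  rw [← hcoord', ← hcoord', ← hcoord x hx] at h1
  rw [covAlong_apply, covAlong_apply, ← frameField_coords hx (mfderiv I J f x (mlieBracket I X Y x)), h1,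
    sub_eq_add_neg (mvfderiv I _ x (X x)), frameField_add, ← neg_one_smul ℝ (mvfderiv I _ x (Y x)),
    frameField_smul, Pi.add_apply, Pi.smul_apply, neg_one_smul, add_sub_add_comm, ← h2]
  abel

end Along

/-! ### Tangent fields, the Gauss formula and symmetry of `h`. -/

section Submanifold

variable {E : Type*} [NormedAddCommGroup E] [NormedSpace ℝ E] [FiniteDimensional ℝ E]
  {H : Type*} [TopologicalSpace H] {I : ModelWithCorners ℝ E H}
  {M : Type*} [TopologicalSpace M] [ChartedSpace H M] [IsManifold I ∞ M]
  {F : Type*} [NormedAddCommGroup F] [NormedSpace ℝ F] [FiniteDimensional ℝ F]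
  {G : Type*} [TopologicalSpace G] {J : ModelWithCorners ℝ F G}
  {N : Type*} [TopologicalSpace N] [ChartedSpace G N] [IsManifold J ∞ N] {f : M → N}

/-- A vector field on the source of an immersion is smooth if its image is smooth along the
immersion. -/
lemma smoothField_of_mfderiv (hf : ContMDiff I J ∞ f)
    (hinj : ∀ x, Function.Injective (mfderiv I J f x)) {X : Π x : M, TangentSpace I x}
    (hX : ContMDiff I J.tangent ∞ (fun x => (⟨f x, mfderiv I J f x (X x)⟩ : TangentBundle J N))) :
    SmoothField X := by
  intro x
  have hx := mem_chart_source H x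
  have hfx := mem_chart_source G (f x)
  let A : M → E →L[ℝ] F := inTangentCoordinates I J id f (mfderiv I J f) x
  have hA : ContMDiffAt I 𝓘(ℝ, E →L[ℝ] F) ∞ A x := (hf x).mfderiv_const (by simp)
  have hAapply : ∀ y, f y ∈ (chartAt G (f x)).source → ∀ c : E,
      A y c = coords J (f x) (mfderiv I J f y (frameField I x c y)) := fun y hy c =>
    Trivialization.continuousLinearMapAt_apply_of_mem ℝ _ hy _
  have hAinj : Function.Injective (A x) := by
    intro c d hcd
    rw [hAapply x hfx, hAapply x hfx] at hcd
    have h1 := congrArg (fun c => frameField J (f x) c (f x)) hcd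
    simp only [frameField_coords hfx] at h1
    rw [← coords_frameField (J := I) hx c, hinj x h1, coords_frameField hx]
  -- `P` inverts `A` on the left only at `x`. Nearby `P ∘ A` is still invertible, and `(P ∘ A)⁻¹ ∘
  -- P` is a smooth left inverse of `A` that recovers `X`.
  obtain ⟨P, hP⟩ := LinearMap.exists_leftInverse_of_injective (A x).toLinearMap
    (LinearMap.ker_eq_bot.2 hAinj)
  let P' : F →L[ℝ] E := P.toContinuousLinearMap
  let B : M → E →L[ℝ] E := fun y => P'.comp (A y)
  have hB : ContMDiffAt I 𝓘(ℝ, E →L[ℝ] E) ∞ B x := contMDiffAt_const.clm_comp hA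
  have hBx : B x = 1 := ContinuousLinearMap.ext fun c => LinearMap.congr_fun hP c
  have hinv : ContMDiffAt I 𝓘(ℝ, E →L[ℝ] E) ∞ (fun y => Ring.inverse (B y)) x := by
    refine ContDiffAt.comp_contMDiffAt (g := Ring.inverse) ?_ hB
    rw [hBx]
    exact contDiffAt_ringInverse ℝ (1 : (E →L[ℝ] E)ˣ)
  have hunit : ∀ᶠ y in 𝓝 x, IsUnit (B y) := by
    refine hB.continuousAt.eventually (Units.isOpen.mem_nhds ?_)
    rw [hBx]
    exact isUnit_one
  have hc : ContMDiffAt I 𝓘(ℝ, F) ∞ (fun y => coords J (f x) (mfderiv I J f y (X y))) x :=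
    (contMDiffAt_totalSpace.1 (hX x)).2
  rw [contMDiffAt_section]
  refine (hinv.clm_apply ((contMDiffAt_const (c := P')).clm_apply hc)).congr_of_eventuallyEq ?_
  filter_upwards [hunit, (chartAt H x).open_source.mem_nhds hx,
    (hf x).continuousAt.eventually ((chartAt G (f x)).open_source.mem_nhds hfx)] with y hu hy hfy
  have h1 := hAapply y hfy (coords I x (X y))
  rw [frameField_coords hy] at h1
  rw [← h1]
  exact (DFunLike.congr_fun (Ring.inverse_mul_cancel _ hu) (coords I x (X y))).symm

lemma SmoothField.cov [RiemannianBundle (fun x : M => TangentSpace I x)]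
    [IsContMDiffRiemannianBundle I ∞ E (fun x : M => TangentSpace I x)]
    {D' : CovariantDerivative I E (fun x : M => TangentSpace I x)} (hD' : IsLeviCivita D')
    {X Y : Π x : M, TangentSpace I x} (hX : SmoothField X) (hY : SmoothField Y) :
    SmoothField (fun y => D' Y y (X y)) := by
  have h := hD'.smooth.contMDiff.contMDiff (σ := Y) (by
    rw [contMDiffOn_univ]; exact hY)
  exact fun x => ((contMDiffOn_univ.1 h) x).clm_bundle_apply (hX x)

variable {x : M}

omit [FiniteDimensional ℝ E] [FiniteDimensional ℝ F] in
lemma mdifferentiableAt_mfderiv_apply (hf : ContMDiff I J ∞ f) {X : Π x : M, TangentSpace I x}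
    (hX : MDifferentiableAt I I.tangent (fun y => (⟨y, X y⟩ : TangentBundle I M)) x) :
    MDifferentiableAt I J.tangent
      (fun y => (⟨f y, mfderiv I J f y (X y)⟩ : TangentBundle J N)) x :=
  ((hf.contMDiff_tangentMap (m := 1) (WithTop.coe_le_coe.2 (le_top : (1 + 1 : ℕ∞) ≤ ⊤))
    ).mdifferentiable (by simp) _).comp x hX

variable [RiemannianBundle (fun x : N => TangentSpace J x)]

omit [IsManifold I ∞ M] [FiniteDimensional ℝ F] [IsManifold J ∞ N] in
lemma normalPart_eq_zero {w : TangentSpace J (f x)} (hw : w ∈ (mfderiv I J f x).range) :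
    normalPart I f x w = 0 :=
  (Submodule.starProjection_apply_eq_zero_iff _).2 (Submodule.le_orthogonal_orthogonal _ hw)

omit [IsManifold I ∞ M] [FiniteDimensional ℝ F] [IsManifold J ∞ N] in
lemma normalPart_zero (x : M) : normalPart (J := J) I f x 0 = 0 :=
  normalPart_eq_zero (zero_mem _)

variable [IsContMDiffRiemannianBundle J ∞ F (fun x : N => TangentSpace J x)]
  [RiemannianBundle (fun x : M => TangentSpace I x)]
  [IsContMDiffRiemannianBundle I ∞ E (fun x : M => TangentSpace I x)]
  {D : CovariantDerivative J F (fun x : N => TangentSpace J x)}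
  {D' : CovariantDerivative I E (fun x : M => TangentSpace I x)}

omit [FiniteDimensional ℝ E] [FiniteDimensional ℝ F] [IsManifold I ∞ M] [IsManifold J ∞ N]
  [IsContMDiffRiemannianBundle J ∞ F (fun x : N => TangentSpace J x)]
  [IsContMDiffRiemannianBundle I ∞ E (fun x : M => TangentSpace I x)] in
lemma IsIsometricImmersion.injective (hf : IsIsometricImmersion I J f) (x : M) :
    Function.Injective (mfderiv I J f x) := by
  rw [injective_iff_map_eq_zero]
  intro u hu
  have h := hf.isometric x u u
  rw [hu, inner_zero_left] at h
  exact inner_self_eq_zero.1 h.symm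

variable [I.Boundaryless] [J.Boundaryless]

/-- The Gauss formula: the tangential part of the connection of the ambient manifold is the
connection of the submanifold. -/
lemma IsLeviCivita.inner_covAlong_mfderiv (hD : IsLeviCivita D) (hD' : IsLeviCivita D')
    (hf : IsIsometricImmersion I J f) {X Y Z : Π x : M, TangentSpace I x}
    (hX : MDifferentiableAt I I.tangent (fun y => (⟨y, X y⟩ : TangentBundle I M)) x)
    (hY : MDifferentiableAt I I.tangent (fun y => (⟨y, Y y⟩ : TangentBundle I M)) x)
    (hZ : MDifferentiableAt I I.tangent (fun y => (⟨y, Z y⟩ : TangentBundle I M)) x) :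
    inner ℝ (covAlong D f (fun y => mfderiv I J f y (Y y)) x (X x)) (mfderiv I J f x (Z x)) =
      inner ℝ (D' Y x (X x)) (Z x) := by
  have hfs := hf.immersion.contMDiff
  -- The defect `δ` is symmetric in its first two slots (both connections are torsion-free) and
  -- antisymmetric in its last two (both are metric, `f` is isometric). Going round the six
  -- permutations gives `δ = -δ`.
  let δ : (X Y Z : Π x : M, TangentSpace I x) → ℝ := fun X Y Z =>
    inner ℝ (covAlong D f (fun y => mfderiv I J f y (Y y)) x (X x)) (mfderiv I J f x (Z x))
      - inner ℝ (D' Y x (X x)) (Z x)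
  have hsymm : ∀ {X Y : Π x : M, TangentSpace I x} (Z : Π x : M, TangentSpace I x),
      MDifferentiableAt I I.tangent (fun y => (⟨y, X y⟩ : TangentBundle I M)) x →
      MDifferentiableAt I I.tangent (fun y => (⟨y, Y y⟩ : TangentBundle I M)) x →
      δ X Y Z = δ Y X Z := by
    intro X Y Z hX hY
    have h1 := congrArg (fun w => (inner ℝ w (mfderiv I J f x (Z x)) : ℝ))
      (hD.covAlong_mfderiv_sub hfs hX hY)
    simp only [inner_sub_left, hf.isometric, hD'.mlieBracket_eq hX hY] at h1
    simp only [δ]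
    linarith
  have hanti : ∀ {Y Z : Π x : M, TangentSpace I x} (X : Π x : M, TangentSpace I x),
      MDifferentiableAt I I.tangent (fun y => (⟨y, Y y⟩ : TangentBundle I M)) x →
      MDifferentiableAt I I.tangent (fun y => (⟨y, Z y⟩ : TangentBundle I M)) x →
      δ X Y Z = -δ X Z Y := by
    intro Y Z X hY hZ
    have h1 := hD.mvfderiv_inner_along (mdifferentiableAt_mfderiv_apply hfs hY)
      (mdifferentiableAt_mfderiv_apply hfs hZ) (X x)
    simp only [hf.isometric] at h1
    rw [hD'.mvfderiv_inner hY hZ] at h1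
    simp only [δ]
    rw [real_inner_comm (mfderiv I J f x (Y x)) (covAlong D f _ x (X x)),
      real_inner_comm (Y x) (D' Z x (X x))]
    linarith
  have h1 := hsymm Z hX hY
  have h2 := hanti Y hX hZ
  have h3 := hsymm X hY hZ
  have h4 := hanti Z hY hX
  have h5 := hsymm Y hZ hX
  have h6 := hanti X hZ hY
  have h0 : δ X Y Z = 0 := by linarith
  exact sub_eq_zero.1 h0

omit [RiemannianBundle (fun x : M => TangentSpace I x)]
  [IsContMDiffRiemannianBundle I ∞ E (fun x : M => TangentSpace I x)] in
/-- The second fundamental form is symmetric. -/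
lemma IsLeviCivita.secondFF_comm (hD : IsLeviCivita D) (hf : ContMDiff I J ∞ f)
    {X Y : Π x : M, TangentSpace I x}
    (hX : MDifferentiableAt I I.tangent (fun y => (⟨y, X y⟩ : TangentBundle I M)) x)
    (hY : MDifferentiableAt I I.tangent (fun y => (⟨y, Y y⟩ : TangentBundle I M)) x) :
    secondFF D f X Y x = secondFF D f Y X x := by
  have h := hD.covAlong_mfderiv_sub hf hX hY
  refine sub_eq_zero.1 ((map_sub _ _ _).symm.trans ?_)
  rw [h]
  exact normalPart_eq_zero ⟨_, rfl⟩

end Submanifold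

/-! ### The second fundamental form of an invariant submanifold. -/

section Kenmotsu

variable {n s : ℕ}
  {E : Type*} [NormedAddCommGroup E] [NormedSpace ℝ E] [FiniteDimensional ℝ E]
  {H : Type*} [TopologicalSpace H] {I : ModelWithCorners ℝ E H}
  {M : Type*} [TopologicalSpace M] [ChartedSpace H M] [IsManifold I ∞ M]
  {F : Type*} [NormedAddCommGroup F] [NormedSpace ℝ F] [FiniteDimensional ℝ F]
  {G : Type*} [TopologicalSpace G] {J : ModelWithCorners ℝ F G}
  {N : Type*} [TopologicalSpace N] [ChartedSpace G N] [IsManifold J ∞ N] {f : M → N}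
  [RiemannianBundle (fun x : N => TangentSpace J x)]
  [IsContMDiffRiemannianBundle J ∞ F (fun x : N => TangentSpace J x)]
  {D : CovariantDerivative J F (fun x : N => TangentSpace J x)}
  {S : MetricFStructure n s J N} {ζ : Fin s → Π x : M, TangentSpace I x}

omit [FiniteDimensional ℝ E] [IsManifold I ∞ M] in
lemma MetricFStructure.IsGeneralizedKenmotsu.covAlong_ξ (hS : S.IsGeneralizedKenmotsu)
    (hD : IsLeviCivita D) (hf : ContMDiff I J ∞ f)
    (hζ : ∀ i x, mfderiv I J f x (ζ i x) = S.ξ i (f x)) (i : Fin s) (x : M)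
    (v : TangentSpace I x) :
    covAlong D f (fun y => mfderiv I J f y (ζ i y)) x v =
      mfderiv I J f x (v - ∑ j, S.η j (f x) (mfderiv I J f x v) • ζ j x) := by
  simp only [hζ]
  rw [covAlong_comp (S.mdifferentiableAt_ξ i (f x)) (hf.mdifferentiable (by simp) x),
    hS.cov_ξ hD i, map_sub, map_sum]
  simp only [map_smul, hζ]

-- The ambient derivative of `ξᵢ` along `M` involves only the direction of differentiation and the
-- `ξⱼ`, all tangent to `M`.
omit [IsManifold I ∞ M] in
lemma MetricFStructure.IsGeneralizedKenmotsu.secondFF_ξ (hS : S.IsGeneralizedKenmotsu)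
    (hD : IsLeviCivita D) (hf : ContMDiff I J ∞ f)
    (hζ : ∀ i x, mfderiv I J f x (ζ i x) = S.ξ i (f x)) (i : Fin s)
    (X : Π x : M, TangentSpace I x) (x : M) :
    secondFF D f X (ζ i) x = 0 := by
  rw [secondFF, hS.covAlong_ξ hD hf hζ]
  exact normalPart_eq_zero ⟨_, rfl⟩

variable [RiemannianBundle (fun x : M => TangentSpace I x)]
  [IsContMDiffRiemannianBundle I ∞ E (fun x : M => TangentSpace I x)]
  {D' : CovariantDerivative I E (fun x : M => TangentSpace I x)}
  [I.Boundaryless] [J.Boundaryless]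

/-- The ambient derivative is already tangent, so by the Gauss formula it is the intrinsic one. -/
lemma MetricFStructure.IsGeneralizedKenmotsu.cov_ξ_tangent (hS : S.IsGeneralizedKenmotsu)
    (hD : IsLeviCivita D) (hD' : IsLeviCivita D') (hf : IsIsometricImmersion I J f)
    (hζ : ∀ i x, mfderiv I J f x (ζ i x) = S.ξ i (f x)) (hζs : ∀ i, SmoothField (ζ i))
    (i : Fin s) (x : M) (v : TangentSpace I x) :
    D' (ζ i) x v = v - ∑ j, S.η j (f x) (mfderiv I J f x v) • ζ j x := by
  refine ext_inner_right ℝ fun w => ?_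
  have hv := FiberBundle.mdifferentiableAt_extend I E (V := fun x : M => TangentSpace I x) v
  have hw := FiberBundle.mdifferentiableAt_extend I E (V := fun x : M => TangentSpace I x) w
  have h := hD.inner_covAlong_mfderiv hD' hf hv ((hζs i x).mdifferentiableAt (by simp)) hw
  rw [hS.covAlong_ξ hD hf.immersion.contMDiff hζ, hf.isometric] at h
  simp only [FiberBundle.extend_apply_self] at h
  exact h.symm

lemma MetricFStructure.IsGeneralizedKenmotsu.secondFF_cov_ξ (hS : S.IsGeneralizedKenmotsu)
    (hD : IsLeviCivita D) (hD' : IsLeviCivita D') (hf : IsIsometricImmersion I J f)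
    (hζ : ∀ i x, mfderiv I J f x (ζ i x) = S.ξ i (f x)) (hζs : ∀ i, SmoothField (ζ i))
    (i : Fin s) {X Y : Π x : M, TangentSpace I x} (hX : SmoothField X) (hY : SmoothField Y)
    (x : M) :
    secondFF D f Y (fun y => D' (ζ i) y (X y)) x = secondFF D f X Y x := by
  have hfs := hf.immersion.contMDiff
  have hYx := (hY x).mdifferentiableAt (by simp)
  -- In its first slot `h` is pointwise linear by definition, so `∇_X ξᵢ` is moved there before
  -- being expanded.
  rw [hD.secondFF_comm hfs hYx (((hX.cov hD' (hζs i)) x).mdifferentiableAt (by simp))]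
  have hζY : ∀ j, normalPart I f x
      (covAlong D f (fun y => mfderiv I J f y (Y y)) x (ζ j x)) = 0 := fun j =>
    (hD.secondFF_comm hfs ((hζs j x).mdifferentiableAt (by simp)) hYx).trans
      (hS.secondFF_ξ hD hfs hζ j Y x)
  simp only [normalPart] at hζY
  rw [secondFF, secondFF, hS.cov_ξ_tangent hD hD' hf hζ hζs]
  simp only [normalPart, map_sub, map_sum, map_smul, hζY, smul_zero, Finset.sum_const_zero,
    sub_zero]

-- Since `h(·, ξᵢ) = 0` identically, both the normal derivative and `h(∇_X Y, ξᵢ)` vanish.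
omit [RiemannianBundle (fun x : M => TangentSpace I x)]
  [IsContMDiffRiemannianBundle I ∞ E (fun x : M => TangentSpace I x)] [I.Boundaryless]
  [J.Boundaryless] in
lemma MetricFStructure.IsGeneralizedKenmotsu.covSecondFF_ξ (hS : S.IsGeneralizedKenmotsu)
    (hD : IsLeviCivita D) (hf : ContMDiff I J ∞ f)
    (hζ : ∀ i x, mfderiv I J f x (ζ i x) = S.ξ i (f x)) (i : Fin s)
    (X Y : Π x : M, TangentSpace I x) (x : M) :
    covSecondFF D D' f X Y (ζ i) x = -secondFF D f Y (fun y => D' (ζ i) y (X y)) x := by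
  have h : secondFF D f Y (ζ i) = fun y => (0 : TangentSpace J (f y)) :=
    funext fun y => hS.secondFF_ξ hD hf hζ i Y y
  rw [covSecondFF, hS.secondFF_ξ hD hf hζ, normalCov, h,
    covAlong_zero (hf.mdifferentiable (by simp) x), normalPart_zero, sub_zero, zero_sub]

omit [IsContMDiffRiemannianBundle J ∞ F (fun x : N => TangentSpace J x)]
  [I.Boundaryless] [J.Boundaryless] in
lemma IsTotallyGeodesic.isParallelSecondFF (hD' : IsLeviCivita D') (hf : ContMDiff I J ∞ f)
    (h : IsTotallyGeodesic I D f) : IsParallelSecondFF D D' f := by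
  intro X Y Z hX hY hZ x
  have h0 : secondFF D f Y Z = fun y => (0 : TangentSpace J (f y)) := funext (h Y Z hY hZ)
  rw [covSecondFF, h _ Z (hX.cov hD' hY) hZ, h Y _ hY (hX.cov hD' hZ), normalCov, h0,
    covAlong_zero (hf.mdifferentiable (by simp) x), normalPart_zero, sub_zero, sub_zero]

end Kenmotsu

end GenKenmotsu

theorem mainTheorem7 (n s m : ℕ)
    {N : Type*} [TopologicalSpace N] [T2Space N]
    [ChartedSpace (EuclideanSpace ℝ (Fin (2 * n + s))) N] [IsManifold (𝓡 (2 * n + s)) ∞ N]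
    [RiemannianBundle (fun x : N => TangentSpace (𝓡 (2 * n + s)) x)]
    [IsContMDiffRiemannianBundle (𝓡 (2 * n + s)) ∞ (EuclideanSpace ℝ (Fin (2 * n + s)))
      (fun x : N => TangentSpace (𝓡 (2 * n + s)) x)]
    (S : GenKenmotsu.MetricFStructure n s (𝓡 (2 * n + s)) N) (hS : S.IsGeneralizedKenmotsu)
    {M : Type*} [TopologicalSpace M] [T2Space M]
    [ChartedSpace (EuclideanSpace ℝ (Fin m)) M] [IsManifold (𝓡 m) ∞ M]
    [RiemannianBundle (fun x : M => TangentSpace (𝓡 m) x)]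
    [IsContMDiffRiemannianBundle (𝓡 m) ∞ (EuclideanSpace ℝ (Fin m))
      (fun x : M => TangentSpace (𝓡 m) x)]
    (f : M → N) (hf : GenKenmotsu.IsIsometricImmersion (𝓡 m) (𝓡 (2 * n + s)) f)
    (hinv : GenKenmotsu.IsInvariant (𝓡 m) S f)
    (D : CovariantDerivative (𝓡 (2 * n + s)) (EuclideanSpace ℝ (Fin (2 * n + s)))
      (fun x : N => TangentSpace (𝓡 (2 * n + s)) x)) (hD : GenKenmotsu.IsLeviCivita D)
    (D' : CovariantDerivative (𝓡 m) (EuclideanSpace ℝ (Fin m))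
      (fun x : M => TangentSpace (𝓡 m) x)) (hD' : GenKenmotsu.IsLeviCivita D') :
    (∃ ζ : Fin s → Π x : M, TangentSpace (𝓡 m) x,
      (∀ i, GenKenmotsu.SmoothField (ζ i) ∧
        ∀ x, mfderiv (𝓡 m) (𝓡 (2 * n + s)) f x (ζ i x) = S.ξ i (f x)) ∧
      ∀ (i : Fin s) (X Y : Π x : M, TangentSpace (𝓡 m) x),
        GenKenmotsu.SmoothField X → GenKenmotsu.SmoothField Y → ∀ x,
          GenKenmotsu.covSecondFF D D' f X Y (ζ i) x =
              -GenKenmotsu.secondFF D f Y (fun y => D' (ζ i) y (X y)) x ∧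
          -GenKenmotsu.secondFF D f Y (fun y => D' (ζ i) y (X y)) x =
              -GenKenmotsu.secondFF D f X Y x) ∧
    (GenKenmotsu.IsParallelSecondFF D D' f ↔ GenKenmotsu.IsTotallyGeodesic (𝓡 m) D f) := by
  have hfs := hf.immersion.contMDiff
  choose ζ hζ using hinv.ξ_mem
  have hζs : ∀ i, GenKenmotsu.SmoothField (ζ i) := fun i => by
    -- The chosen preimages are unique because `df` is injective, and they inherit smoothness from
    -- `ξᵢ ∘ f`.
    refine GenKenmotsu.smoothField_of_mfderiv hfs hf.injective ?_
    simp only [hζ]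
    exact (S.smooth_ξ i).comp hfs
  refine ⟨⟨ζ, fun i => ⟨hζs i, hζ i⟩, fun i X Y hX hY x =>
    ⟨hS.covSecondFF_ξ hD hfs hζ i X Y x,
      congrArg Neg.neg (hS.secondFF_cov_ξ hD hD' hf hζ hζs i hX hY x)⟩⟩, fun h X Y hX hY x => ?_,
    fun h => h.isParallelSecondFF hD' hfs⟩
  -- The bound `1 ≤ s` supplies the index `0`.
  have h1 := h X Y (ζ ⟨0, hS.one_le⟩) hX hY (hζs _) x
  rw [hS.covSecondFF_ξ hD hfs hζ, hS.secondFF_cov_ξ hD hD' hf hζ hζs _ hX hY] at h1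
  exact neg_eq_zero.1 h1
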